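/- Let $\mathscr{A}$ be a (not necessarily unital) $C^*$-algebra and let $\mathscr{X}\neq\{0\}$ be a right Hilbert $\mathscr{A}$-module with $\mathscr{A}$-valued inner product $\langle\cdot,\cdot\rangle$ and norm $\|x\|=\|\langle x,x\rangle\|^{1/2}$. Assume that $\mathscr{X}$ is full, that is, the two-sided ideal of $\mathscr{A}$ generated by all $\langle x,y\rangle$, $x,y\in\mathscr{X}$, is dense in $\mathscr{A}$. For $x,y\in\mathscr{X}$ write $x\perp_B y$ (Birkhoff--James orthogonality) if $\|x+\lambda y\|\ge\|x\|$ for all $\lambda\in\mathbb{C}$. Let $\mathcal{K}(\mathscr{X})$ be the $C^*$-algebra given by the closed linear span, in the adjointable operators on $\mathscr{X}$ with the operator norm, of the operators $\theta_{x,y}\colon z\mapsto x\langle y,z\rangle$, $x,y\in\mathscr{X}$. Then the following statements are equivalent: (i) for all $x,y\in\mathscr{X}$, $x\perp_B y$ implies $\|x+y\|\ge\|y\|$; (ii) $\mathscr{A}$ is isomorphic to $\mathbb{C}$ or $\mathcal{K}(\mathscr{X})$ is isomorphic to $\mathbb{C}$ (as a $C^*$-algebra, i.e. $*$-isomorphic).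 -/

import Mathlib

open scoped RightActions

namespace HilbertModule

/-! A right Hilbert module over a C⋆-algebra `A` is a complete normed space `X` with a
`CStarModule Aᵐᵒᵖ X` structure. In Mathlib's class the algebra acts by `a • x` with
`inner x (a • y) = a * inner x y`; for the opposite algebra this is a right action
`x <• a = MulOpposite.op a • x` and an inner product with `⟪x, y <• a⟫ = ⟪x, y⟫ * a`. -/

section InnerProduct

variable {A X : Type*} [NonUnitalCStarAlgebra A] [PartialOrder A]
  [NormedAddCommGroup X] [NormedSpace ℂ X] [SMul Aᵐᵒᵖ X] [CStarModule Aᵐᵒᵖ X]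

/-- The `A`-valued inner product of a right Hilbert `A`-module. -/
def ip (A : Type*) {X : Type*} [NonUnitalCStarAlgebra A] [PartialOrder A]
    [NormedAddCommGroup X] [NormedSpace ℂ X] [SMul Aᵐᵒᵖ X] [CStarModule Aᵐᵒᵖ X]
    (x y : X) : A :=
  MulOpposite.unop (inner Aᵐᵒᵖ x y)

theorem ip_add_right (x y z : X) : ip A x (y + z) = ip A x y + ip A x z := by
  simp [ip]

theorem ip_smul_right (c : ℂ) (x y : X) : ip A x (c • y) = c • ip A x y := by
  simp [ip]

theorem ip_op_smul_right (x y : X) (a : A) : ip A x (y <• a) = ip A x y * a := by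
  simp [ip]

theorem star_ip (x y : X) : star (ip A x y) = ip A y x := by
  simp [ip, ← MulOpposite.unop_star]

theorem ip_add_left (x y z : X) : ip A (x + y) z = ip A x z + ip A y z := by
  simp [ip]

theorem ip_smul_left (c : ℂ) (x y : X) : ip A (c • x) y = star c • ip A x y := by
  simp [ip]

theorem ip_op_smul_left (x y : X) (a : A) : ip A (x <• a) y = star a * ip A x y := by
  simp [ip]

theorem ip_self_nonneg (x : X) : 0 ≤ ip A x x :=
  CStarModule.inner_self_nonneg (A := Aᵐᵒᵖ) (x := x)

theorem ip_self_eq_zero (x : X) : ip A x x = 0 ↔ x = 0 := by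
  simp [ip, CStarModule.inner_self (A := Aᵐᵒᵖ)]

theorem norm_eq_sqrt_norm_ip (x : X) : ‖x‖ = √‖ip A x x‖ :=
  CStarModule.norm_eq_sqrt_norm_inner_self (A := Aᵐᵒᵖ) x

theorem norm_ip_le [StarOrderedRing A] (x y : X) : ‖ip A x y‖ ≤ ‖x‖ * ‖y‖ :=
  CStarModule.norm_inner_le (A := Aᵐᵒᵖ) X (x := x) (y := y)

theorem norm_sq_eq_norm_ip (x : X) : ‖x‖ ^ 2 = ‖ip A x x‖ := by
  rw [norm_eq_sqrt_norm_ip (A := A) x, Real.sq_sqrt (norm_nonneg _)]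

theorem ext_ip {x y : X} (h : ∀ z : X, ip A z x = ip A z y) : x = y := by
  have h1 : ip A (x - y) (x + (-1 : ℂ) • y) = 0 := by
    rw [ip_add_right, ip_smul_right, h]
    simp
  have h2 : x + (-1 : ℂ) • y = x - y := by
    rw [neg_one_smul, sub_eq_add_neg]
  rw [h2, ip_self_eq_zero, sub_eq_zero] at h1
  exact h1

theorem norm_op_smul_le (x : X) (a : A) : ‖x <• a‖ ≤ ‖x‖ * ‖a‖ := by
  refine (sq_le_sq₀ (norm_nonneg _) (by positivity)).1 ?_
  calc ‖x <• a‖ ^ 2 = ‖star a * ip A x x * a‖ := by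
        rw [norm_sq_eq_norm_ip (A := A), ip_op_smul_left, ip_op_smul_right, mul_assoc]
    _ ≤ ‖star a‖ * ‖ip A x x‖ * ‖a‖ := norm_mul₃_le
    _ = (‖x‖ * ‖a‖) ^ 2 := by rw [norm_star, ← norm_sq_eq_norm_ip]; ring

end InnerProduct

/-- A Hilbert `A`-module `X` is full if the two-sided ideal of `A` generated by all the inner
products `⟪x, y⟫` with `x, y ∈ X` is dense in `A`. -/
def IsFull (A X : Type*) [NonUnitalCStarAlgebra A] [PartialOrder A]
    [NormedAddCommGroup X] [NormedSpace ℂ X] [SMul Aᵐᵒᵖ X] [CStarModule Aᵐᵒᵖ X] : Prop :=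
  Dense (TwoSidedIdeal.span (Set.range fun p : X × X => ip A p.1 p.2) : Set A)

/-- Birkhoff–James orthogonality `x ⊥_B y` in a complex normed space. -/
def BirkhoffJamesOrthogonal {X : Type*} [NormedAddCommGroup X] [NormedSpace ℂ X]
    (x y : X) : Prop :=
  ∀ c : ℂ, ‖x‖ ≤ ‖x + c • y‖

/-- The adjointable operators on a Hilbert `A`-module `X`: an operator together with its
(unique) adjoint. -/
structure Adjointable (A X : Type*) [NonUnitalCStarAlgebra A] [PartialOrder A]
    [NormedAddCommGroup X] [NormedSpace ℂ X] [SMul Aᵐᵒᵖ X] [CStarModule Aᵐᵒᵖ X] where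
  /-- the operator -/
  op : X →L[ℂ] X
  /-- its adjoint -/
  adj : X →L[ℂ] X
  ip_op : ∀ x y : X, ip A (op x) y = ip A x (adj y)

namespace Adjointable

section Algebra

variable {A X : Type*} [NonUnitalCStarAlgebra A] [PartialOrder A]
  [NormedAddCommGroup X] [NormedSpace ℂ X] [SMul Aᵐᵒᵖ X] [CStarModule Aᵐᵒᵖ X]

theorem ip_adj (T : Adjointable A X) (x y : X) : ip A (T.adj x) y = ip A x (T.op y) := by
  rw [← star_ip, ← T.ip_op, star_ip]

theorem op_injective : Function.Injective (op : Adjointable A X → X →L[ℂ] X) := by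
  rintro ⟨T, S, h⟩ ⟨T', S', h'⟩ (rfl : T = T')
  have : S = S' := by
    ext y
    refine ext_ip (A := A) fun z => ?_
    rw [← h, ← h']
  subst this
  rfl

@[ext]
theorem ext {T S : Adjointable A X} (h : ∀ x, T.op x = S.op x) : T = S :=
  op_injective (ContinuousLinearMap.ext h)

instance : Zero (Adjointable A X) := ⟨⟨0, 0, fun x y => by simp [ip]⟩⟩
instance : One (Adjointable A X) := ⟨⟨1, 1, fun x y => by simp⟩⟩
instance : Add (Adjointable A X) :=
  ⟨fun T S => ⟨T.op + S.op, T.adj + S.adj, fun x y => by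
    simp [ip_add_left, ip_add_right, T.ip_op, S.ip_op]⟩⟩
instance : Mul (Adjointable A X) :=
  ⟨fun T S => ⟨T.op * S.op, S.adj * T.adj, fun x y => by simp [T.ip_op, S.ip_op]⟩⟩
instance : SMul ℂ (Adjointable A X) :=
  ⟨fun c T => ⟨c • T.op, star c • T.adj, fun x y => by
    simp only [smul_apply, ip_smul_left, ip_smul_right, T.ip_op]⟩⟩
instance : Neg (Adjointable A X) :=
  ⟨fun T => ⟨-T.op, -T.adj, fun x y => by simpa [ip] using T.ip_op x y⟩⟩
instance : Star (Adjointable A X) := ⟨fun T => ⟨T.adj, T.op, T.ip_adj⟩⟩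

@[simp] theorem zero_op : (0 : Adjointable A X).op = 0 := rfl
@[simp] theorem one_op : (1 : Adjointable A X).op = 1 := rfl
@[simp] theorem add_op (T S : Adjointable A X) : (T + S).op = T.op + S.op := rfl
@[simp] theorem mul_op (T S : Adjointable A X) : (T * S).op = T.op * S.op := rfl
@[simp] theorem smul_op (c : ℂ) (T : Adjointable A X) : (c • T).op = c • T.op := rfl
@[simp] theorem neg_op (T : Adjointable A X) : (-T).op = -T.op := rfl
@[simp] theorem star_op (T : Adjointable A X) : (star T).op = T.adj := rfl

instance : Ring (Adjointable A X) where
  add_assoc _ _ _ := op_injective (add_assoc _ _ _)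
  zero_add _ := op_injective (zero_add _)
  add_zero _ := op_injective (add_zero _)
  add_comm _ _ := op_injective (add_comm _ _)
  left_distrib _ _ _ := op_injective (mul_add _ _ _)
  right_distrib _ _ _ := op_injective (add_mul _ _ _)
  zero_mul _ := op_injective (zero_mul _)
  mul_zero _ := op_injective (mul_zero _)
  mul_assoc _ _ _ := op_injective (mul_assoc _ _ _)
  one_mul _ := op_injective (one_mul _)
  mul_one _ := op_injective (mul_one _)
  neg_add_cancel _ := op_injective (neg_add_cancel _)
  nsmul := nsmulRec
  zsmul := zsmulRec

instance : Module ℂ (Adjointable A X) where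
  one_smul _ := op_injective (one_smul _ _)
  mul_smul _ _ _ := op_injective (mul_smul _ _ _)
  smul_zero _ := op_injective (smul_zero _)
  smul_add _ _ _ := op_injective (smul_add _ _ _)
  add_smul _ _ _ := op_injective (add_smul _ _ _)
  zero_smul _ := op_injective (zero_smul _ _)

instance : Algebra ℂ (Adjointable A X) :=
  Algebra.ofModule (fun _ _ _ => op_injective (smul_mul_assoc _ _ _))
    (fun _ _ _ => op_injective (mul_smul_comm _ _ _))

instance : StarRing (Adjointable A X) where
  star_involutive _ := rfl
  star_mul _ _ := rfl
  star_add _ _ := rfl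

instance : StarModule ℂ (Adjointable A X) where
  star_smul _ _ := op_injective rfl

variable (A X) in
/-- The inclusion of the adjointable operators into the bounded operators. -/
def opHom : Adjointable A X →ₐ[ℂ] X →L[ℂ] X :=
  AlgHom.ofLinearMap ⟨⟨op, fun _ _ => rfl⟩, fun _ _ => rfl⟩ rfl fun _ _ => rfl

/-- The norm of an adjointable operator is its operator norm. -/
noncomputable instance : NormedRing (Adjointable A X) :=
  NormedRing.induced _ _ (opHom A X) op_injective

theorem norm_def (T : Adjointable A X) : ‖T‖ = ‖T.op‖ := rfl

noncomputable instance : NormedAlgebra ℂ (Adjointable A X) where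
  norm_smul_le c T := norm_smul_le c T.op

instance [StarOrderedRing A] : CStarRing (Adjointable A X) where
  norm_mul_self_le T := by
    have h : ‖T.op‖ ≤ √‖star T * T‖ := by
      refine ContinuousLinearMap.opNorm_le_bound _ (Real.sqrt_nonneg _) fun x => ?_
      refine (sq_le_sq₀ (norm_nonneg _) (by positivity)).1 ?_
      calc ‖T.op x‖ ^ 2 = ‖ip A x ((star T * T).op x)‖ := by
            rw [norm_sq_eq_norm_ip (A := A), T.ip_op]; rfl
        _ ≤ ‖x‖ * (‖star T * T‖ * ‖x‖) :=
            (norm_ip_le _ _).trans (mul_le_mul_of_nonneg_left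
              ((star T * T).op.le_opNorm x) (norm_nonneg _))
        _ = (√‖star T * T‖ * ‖x‖) ^ 2 := by
            rw [mul_pow, Real.sq_sqrt (norm_nonneg _)]; ring
    calc ‖T‖ * ‖T‖ ≤ √‖star T * T‖ * √‖star T * T‖ := by gcongr <;> exact h
      _ = ‖star T * T‖ := Real.mul_self_sqrt (norm_nonneg _)

end Algebra

end Adjointable

section Compact

variable {A X : Type*} [NonUnitalCStarAlgebra A] [PartialOrder A] [StarOrderedRing A]
  [NormedAddCommGroup X] [NormedSpace ℂ X] [SMul Aᵐᵒᵖ X] [CStarModule Aᵐᵒᵖ X]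

variable (A) in
/-- The bounded operator `z ↦ x ⟪y, z⟫`. -/
noncomputable def thetaOp (x y : X) : X →L[ℂ] X :=
  LinearMap.mkContinuous
    { toFun := fun z => x <• ip A y z
      map_add' := fun z w => ext_ip (A := A) fun v => by
        simp only [ip_op_smul_right, ip_add_right, mul_add]
      map_smul' := fun c z => ext_ip (A := A) fun v => by
        simp only [ip_op_smul_right, ip_smul_right, mul_smul_comm, RingHom.id_apply] }
    (‖x‖ * ‖y‖) fun z => by
      rw [mul_assoc]
      exact (norm_op_smul_le x _).trans
        (mul_le_mul_of_nonneg_left (norm_ip_le y z) (norm_nonneg x))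

variable (A) in
/-- The operator `θ_{x,y} : z ↦ x ⟪y, z⟫`, whose adjoint is `θ_{y,x}`. -/
noncomputable def theta (x y : X) : Adjointable A X where
  op := thetaOp A x y
  adj := thetaOp A y x
  ip_op z w := by
    change ip A (x <• ip A y z) w = ip A z (y <• ip A x w)
    rw [ip_op_smul_left, ip_op_smul_right, star_ip]

theorem theta_op_apply (x y z : X) : (theta A x y).op z = x <• ip A y z := rfl

theorem star_theta (x y : X) : star (theta A x y) = theta A y x := rfl

theorem theta_mul_theta (x y u v : X) :
    theta A x y * theta A u v = theta A (x <• ip A y u) v := by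
  ext z
  refine ext_ip (A := A) fun w => ?_
  change ip A w (x <• ip A y (u <• ip A v z)) = ip A w ((x <• ip A y u) <• ip A v z)
  simp only [ip_op_smul_right, mul_assoc]

variable (A X) in
/-- The linear span of the operators `θ_{x,y}`; it is a `*`-subalgebra. -/
noncomputable def finiteRank : NonUnitalStarSubalgebra ℂ (Adjointable A X) where
  __ := Submodule.span ℂ (Set.range fun p : X × X => theta A p.1 p.2)
  mul_mem' {T S} hT hS := by
    have key := Submodule.mul_mem_mul hT hS
    rw [Submodule.span_mul_span] at key
    refine Submodule.span_mono ?_ key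
    rintro _ ⟨_, ⟨⟨x, y⟩, rfl⟩, _, ⟨⟨u, v⟩, rfl⟩, rfl⟩
    exact ⟨(x <• ip A y u, v), (theta_mul_theta x y u v).symm⟩
  star_mem' {T} hT := by
    induction hT using Submodule.span_induction with
    | mem T h =>
      obtain ⟨⟨x, y⟩, rfl⟩ := h
      exact Submodule.subset_span ⟨(y, x), rfl⟩
    | zero => rw [star_zero]; exact Submodule.zero_mem _
    | add T S _ _ hT hS => rw [star_add]; exact Submodule.add_mem _ hT hS
    | smul c T _ hT => rw [star_smul]; exact Submodule.smul_mem _ _ hT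

variable (A X) in
/-- The C⋆-algebra `K(X)`: the norm closure of the linear span of the operators `θ_{x,y}`. -/
noncomputable def compactOperators : NonUnitalStarSubalgebra ℂ (Adjointable A X) :=
  (finiteRank A X).topologicalClosure

end Compact

end HilbertModule

/-! If `A` or `K(X)` is a copy of `ℂ`, then `‖x‖ ^ 2` is the value of the isomorphism at `⟪x, x⟫` or
at `θ_{x,x}`. Both are quadratic in `x`, so `X` satisfies the parallelogram law, is a pre-Hilbert
space, and Birkhoff–James orthogonality is ordinary orthogonality; Pythagoras gives (i).

For the converse, unit vectors `u`, `v` with `⟪u, v⟫ = 0` and `⟪u, u⟫⟪v, v⟫ = 0` satisfy `‖u + v‖ =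
‖u - v‖ = 1`, and `u + v` is orthogonal to `-2v`; symmetry would give `1 ≥ 2`
(`eq_zero_of_ip_eq_zero_of_mul_eq_zero`). Cutting a unit vector `x` by functional calculus then
shows that `p = ⟪x, x⟫` is a projection (`ip_self_mul_self_of_norm_eq_one`), and perturbing `x`
inside `x • pAp` shows that `pAp = ℂp` (`exists_ip_self_mul_mul_eq_smul`). Orthogonal unit vectors
have the same projection (`ip_self_eq_of_ip_eq_zero`).

This leaves a dichotomy. If every unit `z` generates `X`, in the sense that `z⟪z, v⟫ = v` for all
`v`, each `θ_{x,y}` is a scalar and `K(X) = ℂ1`. Otherwise some `z` has a nonzero orthogonal vector,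
so `p = ⟪z, z⟫` acts as the identity on `X`, and fullness gives `A = ℂp`. -/

namespace HilbertModule

/-! ### Further rules for the inner product and the right action -/

section Basic

variable {A X : Type*} [NonUnitalCStarAlgebra A] [PartialOrder A]
  [NormedAddCommGroup X] [NormedSpace ℂ X] [SMul Aᵐᵒᵖ X] [CStarModule Aᵐᵒᵖ X]

theorem ip_sub_right (x y z : X) : ip A x (y - z) = ip A x y - ip A x z := by
  simp [ip]

theorem ip_sub_left (x y z : X) : ip A (x - y) z = ip A x z - ip A y z := by
  simp [ip]

theorem op_smul_op_smul (x : X) (a b : A) : (x <• a) <• b = x <• (a * b) :=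
  ext_ip (A := A) fun z => by simp only [ip_op_smul_right, mul_assoc]

theorem add_op_smul (x y : X) (a : A) : (x + y) <• a = x <• a + y <• a :=
  ext_ip (A := A) fun z => by simp only [ip_op_smul_right, ip_add_right, add_mul]

theorem smul_op_smul (c : ℂ) (x : X) (a : A) : (c • x) <• a = c • (x <• a) :=
  ext_ip (A := A) fun z => by simp only [ip_op_smul_right, ip_smul_right, smul_mul_assoc]

theorem op_smul_smul (c : ℂ) (x : X) (a : A) : x <• (c • a) = c • (x <• a) :=
  ext_ip (A := A) fun z => by simp only [ip_op_smul_right, ip_smul_right, mul_smul_comm]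

theorem isSelfAdjoint_ip_self (x : X) : IsSelfAdjoint (ip A x x) := star_ip x x

theorem ip_eq_zero_symm {x y : X} (h : ip A x y = 0) : ip A y x = 0 := by
  rw [← star_ip, h, star_zero]

theorem norm_ip_self_of_norm_eq_one {x : X} (hx : ‖x‖ = 1) : ‖ip A x x‖ = 1 := by
  rw [← norm_sq_eq_norm_ip, hx, one_pow]

theorem norm_inv_norm_smul {x : X} (hx : x ≠ 0) : ‖((‖x‖ : ℂ)⁻¹) • x‖ = 1 := by
  rw [norm_smul, norm_inv, Complex.norm_real, norm_norm, inv_mul_cancel₀ (norm_ne_zero_iff.2 hx)]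

end Basic

/-! ### Hilbert space norms and algebras isomorphic to `ℂ` -/

section Hilbert

/-- The norm identity that makes a normed space a Hilbert space makes Birkhoff–James
orthogonality symmetric. -/
theorem norm_le_norm_add_of_parallelogram {X : Type*} [NormedAddCommGroup X] [NormedSpace ℂ X]
    (h : ∀ x y : X, ‖x + y‖ * ‖x + y‖ + ‖x - y‖ * ‖x - y‖ = 2 * (‖x‖ * ‖x‖ + ‖y‖ * ‖y‖))
    (x y : X) (hxy : BirkhoffJamesOrthogonal x y) : ‖y‖ ≤ ‖x + y‖ := by
  let _ : InnerProductSpace ℂ X := InnerProductSpace.ofNorm ℂ h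
  have h0 : inner ℂ x y = 0 := by
    rcases eq_or_ne y 0 with rfl | hy
    · simp
    have hy2 : ‖y‖ ≠ 0 := norm_ne_zero_iff.2 hy
    set c : ℂ := -(inner ℂ y x / (‖y‖ : ℂ) ^ 2) with hc
    have h1 : inner ℂ y (x + c • y) = 0 := by
      rw [inner_add_right, inner_smul_right, inner_self_eq_norm_sq_to_K, hc]
      have : (‖y‖ : ℂ) ≠ 0 := by exact_mod_cast hy2
      simp only [Complex.coe_algebraMap]
      field_simp
      ring
    -- Here `x + c • y` is the component of `x` orthogonal to `y`. Since `hxy` says it is no shorter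
    -- than `x`, Pythagoras forces `c • y = 0`.
    have h2 : ‖x‖ * ‖x‖ = ‖x + c • y‖ * ‖x + c • y‖ + ‖-(c • y)‖ * ‖-(c • y)‖ := by
      rw [← norm_add_sq_eq_norm_sq_add_norm_sq_of_inner_eq_zero (𝕜 := ℂ), add_neg_cancel_right]
      rw [inner_neg_right, inner_smul_right, ← inner_conj_symm, h1]
      simp
    have h3 := mul_self_le_mul_self (norm_nonneg x) (hxy c)
    have h4 : ‖-(c • y)‖ = 0 := by nlinarith [norm_nonneg (-(c • y))]
    rw [norm_eq_zero, neg_eq_zero, smul_eq_zero] at h4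
    have h5 : c = 0 := h4.resolve_right hy
    rw [h5, zero_smul, add_zero] at h1
    rw [← inner_conj_symm, h1, map_zero]
  have h1 := norm_add_sq_eq_norm_sq_add_norm_sq_of_inner_eq_zero x y h0
  nlinarith [norm_nonneg x, norm_nonneg y, norm_nonneg (x + y)]

/-- Taking `f` complex-valued lets it be the value of an isomorphism onto `ℂ`, where the
parallelogram identity is pure algebra. -/
theorem norm_le_norm_add_of_quadratic {X : Type*} [NormedAddCommGroup X] [NormedSpace ℂ X]
    {f : X → ℂ} (hf : ∀ x, f x = (‖x‖ ^ 2 : ℝ))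
    (h : ∀ x y, f (x + y) + f (x - y) = 2 * (f x + f y))
    (x y : X) (hxy : BirkhoffJamesOrthogonal x y) : ‖y‖ ≤ ‖x + y‖ := by
  refine norm_le_norm_add_of_parallelogram (fun x y => ?_) x y hxy
  have h1 := h x y
  simp only [hf] at h1
  simp only [← sq]
  exact_mod_cast h1

theorem eq_smul_symm_one {B : Type*} [NonUnitalRing B] [StarRing B] [Module ℂ B]
    (φ : B ≃⋆ₐ[ℂ] ℂ) (b : B) : b = φ b • φ.symm 1 := by
  apply EquivLike.injective φ
  rw [map_smul, φ.apply_symm_apply, smul_eq_mul, mul_one]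

/-- The preimage of `1` is a nonzero projection, of norm one by the C⋆-identity, and it spans `B`.
Completeness of `B` is not needed. -/
theorem norm_starAlgEquiv_complex {B : Type*} [NonUnitalNormedRing B] [StarRing B] [CStarRing B]
    [NormedSpace ℂ B] (φ : B ≃⋆ₐ[ℂ] ℂ) (b : B) : ‖φ b‖ = ‖b‖ := by
  set e := φ.symm 1
  have he : ‖e‖ = 1 := by
    have h1 : star e * e = e := by
      rw [← map_star, ← map_mul, star_one, one_mul]
    have h2 := CStarRing.norm_star_mul_self (x := e)
    rw [h1] at h2
    have h3 : ‖e‖ ≠ 0 := by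
      rw [norm_ne_zero_iff]
      exact fun h => one_ne_zero (α := ℂ) (by
        rw [← φ.apply_symm_apply 1, show φ.symm 1 = 0 from h, map_zero])
    exact (mul_left_cancel₀ h3 (by rw [← h2, mul_one])).symm
  conv_rhs => rw [eq_smul_symm_one φ b, norm_smul, he, mul_one]

theorem nonempty_starAlgEquiv_complex {B : Type*} [NonUnitalRing B] [StarRing B] [Module ℂ B]
    [IsScalarTower ℂ B B] [SMulCommClass ℂ B B] [StarModule ℂ B] {e : B} (h0 : e ≠ 0)
    (he : e * e = e) (hs : star e = e) (h : ∀ b : B, ∃ c : ℂ, b = c • e) :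
    Nonempty (B ≃⋆ₐ[ℂ] ℂ) := by
  let f : ℂ →⋆ₙₐ[ℂ] B :=
    { toFun := fun c => c • e
      map_smul' := fun c d => by simp [mul_smul]
      map_zero' := zero_smul _ _
      map_add' := fun c d => add_smul _ _ _
      map_mul' := fun c d => by rw [smul_mul_smul_comm, he]
      map_star' := fun c => by rw [star_smul, hs] }
  have hf : Function.Bijective f := by
    refine ⟨fun c d hcd => smul_left_injective ℂ h0 hcd, fun b => ?_⟩
    obtain ⟨c, hc⟩ := h b
    exact ⟨c, hc.symm⟩
  exact ⟨(StarAlgEquiv.ofBijective f hf).symm⟩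

end Hilbert

/-! ### From an isomorphism with `ℂ` to symmetry of orthogonality -/

section Forward

variable {A X : Type*} [NonUnitalCStarAlgebra A] [PartialOrder A] [StarOrderedRing A]
  [NormedAddCommGroup X] [NormedSpace ℂ X] [SMul Aᵐᵒᵖ X] [CStarModule Aᵐᵒᵖ X]

theorem norm_le_norm_add_of_starAlgEquiv (φ : A ≃⋆ₐ[ℂ] ℂ) (x y : X)
    (hxy : BirkhoffJamesOrthogonal x y) : ‖y‖ ≤ ‖x + y‖ := by
  refine norm_le_norm_add_of_quadratic (f := fun x => φ (ip A x x)) (fun x => ?_) (fun x y => ?_)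
    x y hxy
  · obtain ⟨c, hc⟩ := CStarAlgebra.nonneg_iff_eq_star_mul_self.1 (ip_self_nonneg (A := A) x)
    rw [norm_sq_eq_norm_ip (A := A), hc, CStarRing.norm_star_mul_self,
      ← norm_starAlgEquiv_complex φ, map_mul, map_star]
    simp only [RCLike.star_def, Complex.conj_mul']
    push_cast
    ring
  · simp only [ip_add_left, ip_add_right, ip_sub_left, ip_sub_right, map_add, map_sub]
    ring

theorem norm_theta_self (x : X) : ‖theta A x x‖ = ‖x‖ ^ 2 := by
  refine le_antisymm ?_ ?_
  · rw [sq]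
    exact ContinuousLinearMap.opNorm_le_bound _ (by positivity) fun z => by
      change ‖x <• ip A x z‖ ≤ _
      rw [mul_assoc]
      exact (norm_op_smul_le x _).trans
        (mul_le_mul_of_nonneg_left (norm_ip_le x z) (norm_nonneg x))
  · rcases eq_or_ne x 0 with rfl | hx
    · simp
    have h1 : ‖ip A x ((theta A x x).op x)‖ = ‖x‖ ^ 2 * ‖x‖ ^ 2 := by
      rw [theta_op_apply, ip_op_smul_right, norm_sq_eq_norm_ip (A := A),
        ← CStarRing.norm_star_mul_self, star_ip]
    have h2 := norm_ip_le (A := A) x ((theta A x x).op x)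
    have h3 := (theta A x x).op.le_opNorm x
    rw [← Adjointable.norm_def] at h3
    have h4 : 0 < ‖x‖ := norm_pos_iff.2 hx
    have h5 : ‖x‖ ^ 2 * ‖x‖ ^ 2 ≤ ‖x‖ ^ 2 * ‖theta A x x‖ := by
      rw [← h1]
      refine h2.trans ?_
      calc ‖x‖ * ‖(theta A x x).op x‖ ≤ ‖x‖ * (‖theta A x x‖ * ‖x‖) := by gcongr
        _ = _ := by ring
    exact le_of_mul_le_mul_left h5 (by positivity)

theorem theta_mem_compactOperators (x y : X) : theta A x y ∈ compactOperators A X :=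
  NonUnitalStarSubalgebra.le_topologicalClosure _ (Submodule.subset_span ⟨(x, y), rfl⟩)

theorem theta_parallelogram (x y : X) :
    theta A (x + y) (x + y) + theta A (x - y) (x - y) =
      (2 : ℂ) • (theta A x x + theta A y y) := by
  ext z
  refine ext_ip (A := A) fun w => ?_
  simp only [Adjointable.add_op, add_apply, theta_op_apply, ip_add_left, ip_add_right,
    ip_sub_left, ip_sub_right, ip_op_smul_right, two_smul]
  noncomm_ring

/-- A negative real `c` would make `b` both nonnegative and nonpositive. This reads off the sign of
a scalar in `K(X)` from the order of `A`. -/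
theorem eq_norm_of_smul_eq {a b : A} (ha : 0 ≤ a) (hb : 0 ≤ b) (hb0 : b ≠ 0) {c : ℂ}
    (hc : star c = c) (h : c • a = b) : c = (‖c‖ : ℝ) := by
  obtain ⟨r, rfl⟩ := Complex.conj_eq_iff_real.1 hc
  rcases le_or_gt 0 r with hr | hr
  · rw [Complex.norm_real, Real.norm_of_nonneg hr]
  · refine absurd (le_antisymm ?_ hb) hb0
    rw [← h, ← neg_nonneg, ← neg_smul, ← Complex.ofReal_neg, Complex.coe_smul]
    exact smul_nonneg (neg_nonneg.2 hr.le) ha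

instance : CStarRing (compactOperators A X) where
  norm_mul_self_le T := CStarRing.norm_mul_self_le (T : Adjointable A X)

theorem norm_le_norm_add_of_compactOperators_starAlgEquiv
    (φ : compactOperators A X ≃⋆ₐ[ℂ] ℂ) (x y : X)
    (hxy : BirkhoffJamesOrthogonal x y) : ‖y‖ ≤ ‖x + y‖ := by
  set t : X → compactOperators A X := fun x => ⟨theta A x x, theta_mem_compactOperators x x⟩
    with ht
  refine norm_le_norm_add_of_quadratic (f := fun x => φ (t x)) (fun x => ?_) (fun x y => ?_)
    x y hxy
  · have hn : ‖φ (t x)‖ = ‖x‖ ^ 2 := by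
      rw [norm_starAlgEquiv_complex]
      exact norm_theta_self x
    rw [← hn]
    rcases eq_or_ne x 0 with rfl | hx
    · have : φ (t 0) = 0 := by rw [← norm_eq_zero, hn]; simp
      simp [this]
    set e := φ.symm 1
    have he : star e * e = e := by
      rw [← map_star, ← map_mul, star_one, one_mul]
    have hte : t x = φ (t x) • e := eq_smul_symm_one φ (t x)
    have hte' : theta A x x = φ (t x) • (star (e : Adjointable A X) * e) := by
      conv_lhs => rw [show theta A x x = t x from rfl, hte, ← he]
      rfl
    -- With `θ_{x,x} = c • (e* e)`, pairing its value at `x` with `x` gives `⟪x, x⟫² = c • ⟪e x, e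
    -- x⟫`, hence `c ≥ 0`.
    refine eq_norm_of_smul_eq (a := ip A ((e : Adjointable A X).op x) ((e : Adjointable A X).op x))
      (b := ip A x ((theta A x x).op x)) (ip_self_nonneg _) ?_ ?_ ?_ ?_
    · rw [theta_op_apply, ip_op_smul_right]
      nth_rw 1 [← star_ip]
      exact star_mul_self_nonneg _
    · rw [theta_op_apply, ip_op_smul_right, ← norm_ne_zero_iff]
      nth_rw 1 [← star_ip]
      rw [CStarRing.norm_star_mul_self, ← norm_sq_eq_norm_ip]
      have : ‖x‖ ≠ 0 := norm_ne_zero_iff.2 hx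
      positivity
    · rw [← map_star]
      rfl
    · conv_rhs => rw [hte']
      rw [Adjointable.ip_op, ← ip_smul_right]
      rfl
  · have h : t (x + y) + t (x - y) = (2 : ℂ) • (t x + t y) :=
      Subtype.ext (theta_parallelogram x y)
    rw [← map_add, h, map_smul, map_add, smul_eq_mul]

end Forward

/-! ### From symmetry of orthogonality to an isomorphism with `ℂ` -/

theorem apply_eq_zero_of_cfcₙ_eq_zero {A : Type*} [NonUnitalCStarAlgebra A] {a : A} (ha : IsSelfAdjoint a) {f : ℝ → ℝ}
    (hf : Continuous f) (hf0 : f 0 = 0) (h : cfcₙ f a = 0) {s : ℝ} (hs : s ∈ quasispectrum ℝ a) :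
    f s = 0 := by
  have h1 := norm_apply_le_norm_cfcₙ f a hs hf.continuousOn hf0 ha
  rw [h, norm_zero] at h1
  exact norm_le_zero_iff.1 h1

section Reverse

variable {A X : Type*} [NonUnitalCStarAlgebra A] [PartialOrder A] [StarOrderedRing A]
  [NormedAddCommGroup X] [NormedSpace ℂ X] [SMul Aᵐᵒᵖ X] [CStarModule Aᵐᵒᵖ X]

/-- Birkhoff–James symmetry forbids two nonzero vectors that are orthogonal and have orthogonal
supports. -/
theorem eq_zero_of_ip_eq_zero_of_mul_eq_zero
    (H : ∀ x y : X, BirkhoffJamesOrthogonal x y → ‖y‖ ≤ ‖x + y‖) {x y : X} (hx : x ≠ 0)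
    (h : ip A x y = 0) (hm : ip A x x * ip A y y = 0) : y = 0 := by
  by_contra hy
  set u := ((‖x‖ : ℂ)⁻¹) • x with hu
  set v := ((‖y‖ : ℂ)⁻¹) • y with hv
  have hu1 : ‖u‖ = 1 := norm_inv_norm_smul hx
  have hv1 : ‖v‖ = 1 := norm_inv_norm_smul hy
  have huv : ip A u v = 0 := by
    rw [hu, hv, ip_smul_left, ip_smul_right, h, smul_zero, smul_zero]
  have hvu : ip A v u = 0 := ip_eq_zero_symm huv
  have huvm : ip A u u * ip A v v = 0 := by
    simp only [hu, hv, ip_smul_left, ip_smul_right, smul_mul_assoc, mul_smul_comm, hm, smul_zero]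
  have hadd : ∀ c : ℂ, ‖c‖ = 1 → ‖u + c • v‖ = 1 := fun c hc => by
    have hip : ip A (u + c • v) (u + c • v) = ip A u u + ip A v v := by
      simp only [ip_add_left, ip_add_right, ip_smul_left, ip_smul_right, huv, hvu, smul_zero,
        add_zero, zero_add, smul_smul, RCLike.star_def, Complex.mul_conj', hc]
      simp
    rw [norm_eq_sqrt_norm_ip (A := A), hip,
      (isSelfAdjoint_ip_self u).norm_add_eq_max (isSelfAdjoint_ip_self v) huvm,
      norm_ip_self_of_norm_eq_one hu1, norm_ip_self_of_norm_eq_one hv1, max_self, Real.sqrt_one]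
  -- Pairing with `u` removes every multiple of `v` and bounds the norm below by one. The factor
  -- `-2` turns `u + v` into `u - v`, of norm one, although `-2v` has norm two.
  have h1 : BirkhoffJamesOrthogonal (u + v) ((-2 : ℂ) • v) := fun c => by
    have h2 := hadd 1 norm_one
    rw [one_smul] at h2
    rw [h2]
    have h3 := norm_ip_le (A := A) u (u + v + c • (-2 : ℂ) • v)
    simp only [ip_add_right, ip_smul_right, huv, smul_zero, add_zero, hu1, one_mul,
      norm_ip_self_of_norm_eq_one hu1] at h3
    exact h3
  have h2 := H _ _ h1
  have h3 := hadd (-1) (by simp)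
  rw [show u + v + (-2 : ℂ) • v = u + (-1 : ℂ) • v by module, h3, norm_smul, hv1] at h2
  norm_num at h2

/-- A spectral point of `a = ⟪x, x⟫` strictly between `0` and `1` would allow `x` to be split into
nonzero pieces `x f(a)`, `x g(a)` with `f g = 0`, which symmetry forbids. So the spectrum lies in
`{0, 1}`. -/
theorem ip_self_mul_self_of_norm_eq_one
    (H : ∀ x y : X, BirkhoffJamesOrthogonal x y → ‖y‖ ≤ ‖x + y‖) {x : X} (hx : ‖x‖ = 1) :
    ip A x x * ip A x x = ip A x x := by
  set a := ip A x x with ha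
  have hsa : IsSelfAdjoint a := isSelfAdjoint_ip_self x
  have hn : ‖a‖ = 1 := norm_ip_self_of_norm_eq_one hx
  have hid : cfcₙ (fun s : ℝ => s) a = a := cfcₙ_id' ℝ a
  have hpos : ∀ s ∈ quasispectrum ℝ a, 0 ≤ s := fun s hs =>
    quasispectrum_nonneg_of_nonneg a (ip_self_nonneg x) s hs
  have hip : ∀ f g : ℝ → ℝ, Continuous f → Continuous g → f 0 = 0 → g 0 = 0 →
      ip A (x <• cfcₙ f a) (x <• cfcₙ g a) = cfcₙ (fun s => f s * (s * g s)) a := by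
    intro f g hf hg hf0 hg0
    have hF : star (cfcₙ f a) = cfcₙ f a := cfcₙ_predicate f a
    rw [ip_op_smul_left, ip_op_smul_right, ← ha, hF,
      cfcₙ_mul f (fun s => s * g s) a hf.continuousOn hf0 (by fun_prop) (by simp),
      cfcₙ_mul (fun s => s) g a (by fun_prop) rfl hg.continuousOn hg0, hid]
  have hgap : ∀ s ∈ quasispectrum ℝ a, 0 < s → 1 ≤ s := by
    intro s hs h0
    by_contra! h1
    obtain ⟨m, hsm, hm1⟩ := exists_between h1
    -- `f` lives above `m` and `g` below it; the factor `t` in `g` gives `g 0 = 0`, as the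
    -- non-unital calculus requires.
    set f : ℝ → ℝ := fun t => max 0 (t - m) with hf
    set g : ℝ → ℝ := fun t => t * max 0 (m - t) with hg
    have hfc : Continuous f := by fun_prop
    have hgc : Continuous g := by fun_prop
    have hf0 : f 0 = 0 := by simp only [hf]; exact max_eq_left (by linarith)
    have hg0 : g 0 = 0 := by simp [hg]
    have hfg : ∀ t, f t * g t = 0 := fun t => by
      simp only [hf, hg]
      rcases le_total t m with h | h
      · rw [max_eq_left (by linarith : t - m ≤ 0), zero_mul]
      · rw [max_eq_left (by linarith : m - t ≤ 0), mul_zero, mul_zero]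
    have hzero : ∀ h : ℝ → ℝ, (∀ t, h t = 0) → cfcₙ h a = 0 := fun h h0 => by
      rw [show h = 0 from funext h0, cfcₙ_zero]
    have hx1 : x <• cfcₙ f a ≠ 0 := by
      intro h
      rw [← ip_self_eq_zero (A := A), hip f f hfc hfc hf0 hf0] at h
      -- If `x f(a)` vanished, the spectrum would lie in `[0, m]`, against `‖a‖ = 1`.
      have hle : ‖cfcₙ (fun t : ℝ => t) a‖ ≤ m := norm_cfcₙ_le fun t ht => by
        have h2 := apply_eq_zero_of_cfcₙ_eq_zero hsa (by fun_prop) (by simp) h ht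
        rw [Real.norm_of_nonneg (hpos t ht)]
        by_contra! hmt
        have h3 : 0 < f t := lt_max_of_lt_right (by linarith)
        have h4 : 0 < t := by linarith
        exact absurd h2 (by positivity)
      rw [hid, hn] at hle
      linarith
    have hx2 : x <• cfcₙ g a = 0 := by
      refine eq_zero_of_ip_eq_zero_of_mul_eq_zero (A := A) H hx1 ?_ ?_
      · rw [hip f g hfc hgc hf0 hg0]
        exact hzero _ fun t => by linear_combination t * hfg t
      · rw [hip f f hfc hfc hf0 hf0, hip g g hgc hgc hg0 hg0,
          ← cfcₙ_mul _ _ a (by fun_prop) (by simp) (by fun_prop) (by simp)]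
        exact hzero _ fun t => by linear_combination t ^ 2 * f t * g t * hfg t
    rw [← ip_self_eq_zero (A := A), hip g g hgc hgc hg0 hg0] at hx2
    have h2 := apply_eq_zero_of_cfcₙ_eq_zero hsa (by fun_prop) (by simp) hx2 hs
    have h3 : 0 < g s := mul_pos h0 (lt_max_of_lt_right (by linarith))
    exact absurd h2 (by positivity)
  conv_lhs => rw [← hid]
  rw [← cfcₙ_mul (fun s : ℝ => s) (fun s => s) a (by fun_prop) rfl (by fun_prop) rfl]
  conv_rhs => rw [← hid]
  refine cfcₙ_congr fun s hs => ?_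
  have hs1 : s ≤ 1 := by
    have h1 := norm_apply_le_norm_cfcₙ (fun s : ℝ => s) a hs (by fun_prop) rfl hsa
    rw [hid, hn] at h1
    exact (le_abs_self s).trans h1
  rcases (hpos s hs).eq_or_lt with h | h
  · simp [← h]
  · simp [le_antisymm hs1 (hgap s hs h)]

theorem ip_self_mul_self (H : ∀ x y : X, BirkhoffJamesOrthogonal x y → ‖y‖ ≤ ‖x + y‖) (x : X) :
    ip A x x * ip A x x = ((‖x‖ : ℂ) ^ 2) • ip A x x := by
  rcases eq_or_ne x 0 with rfl | hx
  · simp [ip]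
  have h0 : (‖x‖ : ℂ) ≠ 0 := by exact_mod_cast norm_ne_zero_iff.2 hx
  have h := ip_self_mul_self_of_norm_eq_one (A := A) H (norm_inv_norm_smul hx)
  simp only [ip_smul_left, ip_smul_right, smul_mul_assoc, mul_smul_comm, smul_smul] at h
  have h1 := congrArg (fun b => ((‖x‖ : ℂ) ^ 4) • b) h
  simp only [smul_smul] at h1
  convert h1 using 2
  · rw [← one_smul ℂ (ip A x x * ip A x x), smul_smul]
    congr 1
    simp
    field_simp
  · simp
    field_simp

theorem op_smul_ip_self_eq_smul (H : ∀ x y : X, BirkhoffJamesOrthogonal x y → ‖y‖ ≤ ‖x + y‖)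
    (x : X) : x <• ip A x x = ((‖x‖ : ℂ) ^ 2) • x := by
  have h : ip A (x <• ip A x x - ((‖x‖ : ℂ) ^ 2) • x) (x <• ip A x x - ((‖x‖ : ℂ) ^ 2) • x)
      = 0 := by
    simp only [ip_sub_left, ip_sub_right, ip_op_smul_left, ip_op_smul_right, star_ip,
      ip_smul_left, ip_smul_right, ip_self_mul_self H, sub_mul, smul_mul_assoc, smul_smul]
    simp
  rwa [ip_self_eq_zero, sub_eq_zero] at h

theorem op_smul_ip_self_of_norm_eq_one
    (H : ∀ x y : X, BirkhoffJamesOrthogonal x y → ‖y‖ ≤ ‖x + y‖) {x : X} (hx : ‖x‖ = 1) :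
    x <• ip A x x = x := by
  simpa [hx] using op_smul_ip_self_eq_smul (A := A) H x

theorem ip_self_mul_ip (H : ∀ x y : X, BirkhoffJamesOrthogonal x y → ‖y‖ ≤ ‖x + y‖) {x : X}
    (hx : ‖x‖ = 1) (y : X) : ip A x x * ip A x y = ip A x y := by
  rw [← star_ip x x, ← ip_op_smul_left, op_smul_ip_self_of_norm_eq_one H hx]

/-- The vector `z + w` is fixed by `p + q` up to a scalar `c`. Pairing with `z` and `w` gives `pq =
(c - 1)p` and `qp = (c - 1)q`; adjoints give `(c - 1)p = (c - 1)q`. The case `c = 1` means `pq = 0`,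
which is excluded. -/
theorem ip_self_eq_of_ip_eq_zero
    (H : ∀ x y : X, BirkhoffJamesOrthogonal x y → ‖y‖ ≤ ‖x + y‖) {z w : X} (hz : ‖z‖ = 1)
    (hw : ‖w‖ = 1) (h : ip A z w = 0) : ip A z z = ip A w w := by
  have h' := ip_eq_zero_symm h
  set p := ip A z z with hp
  set q := ip A w w with hq
  have h1 : ip A (z + w) (z + w) = p + q := by
    simp [ip_add_left, ip_add_right, h, h', hp, hq]
  have h2 : ip A (z - w) (z - w) = p + q := by
    simp [ip_sub_left, ip_sub_right, h, h', hp, hq]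
  have h3 : ‖z - w‖ = ‖z + w‖ := by
    rw [norm_eq_sqrt_norm_ip (A := A), h2, ← h1, ← norm_eq_sqrt_norm_ip]
  set c : ℂ := (‖z + w‖ : ℂ) ^ 2 with hc
  have hcs : star c = c := by simp [hc]
  have e1 := op_smul_ip_self_eq_smul (A := A) H (z + w)
  have e2 := op_smul_ip_self_eq_smul (A := A) H (z - w)
  rw [h1, ← hc] at e1
  rw [h2, h3, ← hc] at e2
  have f1 := congrArg (ip A z) e1
  have f2 := congrArg (ip A w) e1
  simp only [ip_op_smul_right, ip_add_right, ip_smul_right, h, h', add_zero, zero_add, mul_add,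
    ← hp, ← hq] at f1 f2
  rw [hp, ip_self_mul_self_of_norm_eq_one H hz, ← hp] at f1
  rw [hq, ip_self_mul_self_of_norm_eq_one H hw, ← hq] at f2
  have f3 := congrArg star f1
  rw [star_add, star_mul, star_smul, hcs, hp, hq, star_ip, star_ip, ← hp, ← hq] at f3
  have f4 : (c - 1) • p = (c - 1) • q := by
    rw [sub_smul, sub_smul, ← f3, ← f2]
    simp
  by_cases hc1 : c - 1 = 0
  · have : p * q = 0 := by
      rw [sub_eq_zero.1 hc1, one_smul] at f1
      simpa using f1
    have hw0 := eq_zero_of_ip_eq_zero_of_mul_eq_zero (A := A) H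
      (norm_ne_zero_iff.1 (by rw [hz]; exact one_ne_zero)) h this
    rw [hw0, norm_zero] at hw
    exact absurd hw zero_ne_one
  · exact smul_right_injective A hc1 f4

theorem op_smul_eq_of_ip_eq_zero
    (H : ∀ x y : X, BirkhoffJamesOrthogonal x y → ‖y‖ ≤ ‖x + y‖) {z v : X} (hz : ‖z‖ = 1)
    (h : ip A z v = 0) : v <• ip A z z = v := by
  rcases eq_or_ne v 0 with rfl | hv
  · exact ext_ip (A := A) fun z => by simp [ip]
  have h1 := ip_self_eq_of_ip_eq_zero (A := A) H hz (norm_inv_norm_smul hv)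
    (by rw [ip_smul_right, h, smul_zero])
  have h2 := op_smul_ip_self_of_norm_eq_one (A := A) H (norm_inv_norm_smul hv)
  rw [← h1, smul_op_smul] at h2
  refine smul_right_injective X (r := (‖v‖ : ℂ)⁻¹) ?_ h2
  exact inv_ne_zero (by exact_mod_cast norm_ne_zero_iff.2 hv)

/-- The inner square `p + k` of `x(p + h)` is a multiple of a projection, yet for small `h` it is
invertible in `pAp`; so it is a multiple of `p`. -/
theorem exists_ip_self_add_eq_smul
    (H : ∀ x y : X, BirkhoffJamesOrthogonal x y → ‖y‖ ≤ ‖x + y‖) {x : X} (hx : ‖x‖ = 1) {h : A}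
    (hl : ip A x x * h = h) (hr : h * ip A x x = h) (hn : ‖h‖ ≤ 1 / 8) :
    ∃ c : ℂ, h + star h + star h * h = c • ip A x x := by
  set p := ip A x x with hp
  have hpp : p * p = p := ip_self_mul_self_of_norm_eq_one H hx
  have hps : star p = p := star_ip x x
  have hl' : star h * p = star h := by
    conv_lhs => rw [← hps, ← star_mul, hl]
  have hr' : p * star h = star h := by
    conv_lhs => rw [← hps, ← star_mul, hr]
  set k := h + star h + star h * h with hk
  have hd : ip A (x <• (p + h)) (x <• (p + h)) = p + k := by
    rw [ip_op_smul_left, ip_op_smul_right, ← hp, star_add, hps, hk]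
    simp only [mul_add, add_mul, hpp, hl, hl']
    abel
  have hpk : p * k = k := by
    rw [hk, mul_add, mul_add, hl, hr', ← mul_assoc, hr']
  have hkp : k * p = k := by
    rw [hk, add_mul, add_mul, hr, hl', mul_assoc, hr]
  have hkn : ‖k‖ ≤ 1 / 2 := by
    have h1 : ‖k‖ ≤ ‖h‖ + ‖h‖ + ‖h‖ * ‖h‖ := by
      refine (norm_add₃_le).trans ?_
      rw [norm_star, CStarRing.norm_star_mul_self]
    nlinarith [norm_nonneg h]
  have key := ip_self_mul_self (A := A) H (x <• (p + h))
  rw [hd] at key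
  set c : ℂ := (‖x <• (p + h)‖ : ℂ) ^ 2
  set t := p + k - c • p with ht
  -- `(p + k)t = 0` and `pt = t`; since `‖k‖ ≤ 1/2`, this kills `t`.
  have h1 : t = -(k * t) := by
    have h2 : (p + k) * t = 0 := by
      rw [ht, mul_sub, key, mul_smul_comm, add_mul, hpp, hkp, sub_self]
    have h3 : p * t = t := by
      rw [ht, mul_sub, mul_add, mul_smul_comm, hpp, hpk]
    rw [add_mul, h3] at h2
    exact eq_neg_of_add_eq_zero_left h2
  have h2 : ‖t‖ ≤ 1 / 2 * ‖t‖ := by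
    conv_lhs => rw [h1, norm_neg]
    exact (norm_mul_le _ _).trans (by gcongr)
  have h3 : t = 0 := norm_le_zero_iff.1 (by linarith [norm_nonneg t])
  refine ⟨c - 1, ?_⟩
  rw [ht, sub_eq_zero] at h3
  rw [sub_smul, one_smul, ← h3, add_sub_cancel_left]

theorem exists_add_star_eq_smul
    (H : ∀ x y : X, BirkhoffJamesOrthogonal x y → ‖y‖ ≤ ‖x + y‖) {x : X} (hx : ‖x‖ = 1) {h : A}
    (hl : ip A x x * h = h) (hr : h * ip A x x = h) (hn : ‖h‖ ≤ 1 / 8) :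
    ∃ c : ℂ, h + star h = c • ip A x x := by
  obtain ⟨c, hc⟩ := exists_ip_self_add_eq_smul H hx hl hr hn
  -- Subtracting the relations for `h` and `-h` cancels the quadratic term.
  obtain ⟨d, hd⟩ := exists_ip_self_add_eq_smul H hx (h := -h) (by rw [mul_neg, hl])
    (by rw [neg_mul, hr]) (by rwa [norm_neg])
  refine ⟨(c - d) / 2, ?_⟩
  have h1 : (2 : ℂ) • (h + star h) = (c - d) • ip A x x := by
    rw [sub_smul, ← hc, ← hd, star_neg, neg_mul_neg, two_smul]
    abel
  rw [div_eq_inv_mul, mul_smul, ← h1, smul_smul, inv_mul_cancel₀ two_ne_zero, one_smul]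

/-- The support projection of a unit vector is minimal. -/
theorem exists_ip_self_mul_mul_eq_smul
    (H : ∀ x y : X, BirkhoffJamesOrthogonal x y → ‖y‖ ≤ ‖x + y‖) {x : X} (hx : ‖x‖ = 1) (a : A) :
    ∃ c : ℂ, ip A x x * a * ip A x x = c • ip A x x := by
  have hpp := ip_self_mul_self_of_norm_eq_one (A := A) H hx
  set p := ip A x x with hp
  set b := p * a * p with hb
  have hbl : p * b = b := by rw [hb, ← mul_assoc, ← mul_assoc, hpp]
  have hbr : b * p = b := by rw [hb, mul_assoc, hpp]
  have hpos : 0 < 8 * (‖b‖ + 1) := by positivity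
  -- Scaling by `e` brings `b` below norm `1/8`; applying `hpart` to `e` and `Complex.I * e` handles
  -- the real and imaginary parts of `b`.
  set e : ℂ := ((8 * (‖b‖ + 1) : ℝ) : ℂ)⁻¹ with he
  have he0 : e ≠ 0 := inv_ne_zero (by exact_mod_cast hpos.ne')
  have hen : ‖e‖ * ‖b‖ ≤ 1 / 8 := by
    rw [he, norm_inv, Complex.norm_real, Real.norm_of_nonneg hpos.le, inv_mul_le_iff₀ hpos]
    linarith
  have hpart : ∀ d : ℂ, ‖d‖ = ‖e‖ → ∃ c : ℂ, d • b + star (d • b) = c • p := fun d hd =>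
    exists_add_star_eq_smul H hx (by rw [mul_smul_comm, ← hp, hbl])
      (by rw [smul_mul_assoc, ← hp, hbr]) (by rwa [norm_smul, hd])
  obtain ⟨c, hc⟩ := hpart e rfl
  obtain ⟨d, hd⟩ := hpart (Complex.I * e) (by simp)
  refine ⟨e⁻¹ * ((c - Complex.I * d) / 2), ?_⟩
  have hes : star e = e := by
    simp [he]
  have h1 : (2 * e) • b = (c - Complex.I * d) • p := by
    rw [sub_smul, mul_smul _ d, ← hc, ← hd, star_smul, star_smul, star_mul Complex.I e, hes]
    simp only [RCLike.star_def, Complex.conj_I, smul_add, smul_smul]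
    rw [show Complex.I * (Complex.I * e) = -e by rw [← mul_assoc, Complex.I_mul_I, neg_one_mul],
      show Complex.I * (e * -Complex.I) = e by linear_combination -e * Complex.I_mul_I]
    module
  rw [show e⁻¹ * ((c - Complex.I * d) / 2) = (2 * e)⁻¹ * (c - Complex.I * d) by field_simp,
    mul_smul, ← h1, smul_smul, inv_mul_cancel₀ (mul_ne_zero two_ne_zero he0), one_smul]

/-- Pairing `(z a)p = z a` with `z` gives `pa = pap`, and adjoints give `ap = pap`. So `ℂp = pAp` is
a closed two-sided ideal; it contains every inner product, and by density it is `A`. -/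
theorem nonempty_starAlgEquiv_of_op_smul_eq
    (H : ∀ x y : X, BirkhoffJamesOrthogonal x y → ‖y‖ ≤ ‖x + y‖) (hfull : IsFull A X)
    {z : X} (hz : ‖z‖ = 1) (h : ∀ y : X, y <• ip A z z = y) : Nonempty (A ≃⋆ₐ[ℂ] ℂ) := by
  have hpp := ip_self_mul_self_of_norm_eq_one (A := A) H hz
  have hps : star (ip A z z) = ip A z z := star_ip z z
  have hmin := exists_ip_self_mul_mul_eq_smul (A := A) H hz
  have hn := norm_ip_self_of_norm_eq_one (A := A) hz
  have hpa : ∀ a : A, ip A z z * a = ip A z z * a * ip A z z := fun a => by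
    rw [← ip_op_smul_right, ← ip_op_smul_right, h]
  set p := ip A z z with hp
  have hap : ∀ a : A, a * p = p * a * p := fun a => by
    have h1 := congrArg star (hpa (star a))
    simpa only [star_mul, star_star, hps, mul_assoc] using h1
  let I : TwoSidedIdeal A := TwoSidedIdeal.mk' (Submodule.span ℂ {p} : Set A)
    (Submodule.zero_mem _) (Submodule.add_mem _) (Submodule.neg_mem _)
    (by
      intro a b hb
      obtain ⟨c, rfl⟩ := Submodule.mem_span_singleton.1 hb
      obtain ⟨d, hd⟩ := hmin a
      rw [mul_smul_comm, hap, hd]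
      exact Submodule.smul_mem _ _ (Submodule.smul_mem _ _ (Submodule.mem_span_singleton_self p)))
    (by
      intro b a hb
      obtain ⟨c, rfl⟩ := Submodule.mem_span_singleton.1 hb
      obtain ⟨d, hd⟩ := hmin a
      rw [smul_mul_assoc, hpa, hd]
      exact Submodule.smul_mem _ _ (Submodule.smul_mem _ _ (Submodule.mem_span_singleton_self p)))
  have hI : (I : Set A) = Submodule.span ℂ {p} := TwoSidedIdeal.coe_mk' ..
  have hle : TwoSidedIdeal.span (Set.range fun q : X × X => ip A q.1 q.2) ≤ I := by
    rw [TwoSidedIdeal.span_le]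
    rintro _ ⟨⟨x, y⟩, rfl⟩
    rw [hI]
    obtain ⟨c, hc⟩ := hmin (ip A x y)
    refine Submodule.mem_span_singleton.2 ⟨c, ?_⟩
    have h1 : ip A x y = p * ip A x y * p := by
      conv_lhs => rw [← h x, ← h y, ip_op_smul_left, ip_op_smul_right, hps, ← mul_assoc]
    exact hc.symm.trans h1.symm
  have hcl : IsClosed (Submodule.span ℂ {p} : Set A) := Submodule.closed_of_finiteDimensional _
  have htop : ∀ a : A, a ∈ Submodule.span ℂ {p} := fun a => by
    have h1 : a ∈ closure (Submodule.span ℂ {p} : Set A) :=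
      closure_mono (by rw [← hI]; exact hle) (hfull a)
    rwa [hcl.closure_eq] at h1
  refine nonempty_starAlgEquiv_complex (e := p)
    (norm_ne_zero_iff.1 (by rw [hn]; exact one_ne_zero)) hpp hps fun a => ?_
  obtain ⟨c, hc⟩ := Submodule.mem_span_singleton.1 (htop a)
  exact ⟨c, hc.symm⟩

theorem nonempty_compactOperators_starAlgEquiv [Nontrivial X]
    (H : ∀ x y : X, BirkhoffJamesOrthogonal x y → ‖y‖ ≤ ‖x + y‖)
    (h : ∀ z v : X, ‖z‖ = 1 → z <• ip A z v = v) :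
    Nonempty (compactOperators A X ≃⋆ₐ[ℂ] ℂ) := by
  have hunit : ∀ x y : X, ‖y‖ = 1 → ∃ c : ℂ, theta A x y = c • 1 := fun x y hy => by
    obtain ⟨c, hc⟩ := exists_ip_self_mul_mul_eq_smul (A := A) H hy (ip A y x)
    refine ⟨c, Adjointable.ext fun v => ?_⟩
    change x <• ip A y v = c • v
    -- Writing `x = y⟪y, x⟫` and inserting `p = ⟪y, y⟫` turns `x⟪y, v⟫` into `y (p⟪y, x⟫p) ⟪y, v⟫`,
    -- and minimality of `p` yields `c • y⟪y, v⟫ = c • v`.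
    conv_lhs => rw [← h y x hy, op_smul_op_smul, ← ip_self_mul_ip H hy x,
      ← ip_self_mul_ip H hy v, ← mul_assoc, hc, smul_mul_assoc, ip_self_mul_ip H hy,
      op_smul_smul, h y v hy]
  have hspan : ∀ x y : X, ∃ c : ℂ, theta A x y = c • 1 := fun x y => by
    rcases eq_or_ne y 0 with rfl | hy
    · refine ⟨0, Adjointable.ext fun v => ext_ip (A := A) fun w => ?_⟩
      rw [theta_op_apply, ip_op_smul_right]
      simp [ip]
    · obtain ⟨c, hc⟩ := hunit x _ (norm_inv_norm_smul hy)
      refine ⟨‖y‖ * c, Adjointable.ext fun v => ?_⟩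
      have h1 := congrArg (fun T : Adjointable A X => T.op v) hc
      change x <• ip A _ v = c • v at h1
      change x <• ip A y v = (‖y‖ * c) • v
      have h0 : (‖y‖ : ℂ) ≠ 0 := by exact_mod_cast norm_ne_zero_iff.2 hy
      rw [mul_smul, ← h1, ip_smul_left, op_smul_smul, smul_smul]
      simp [h0]
  have hcl : IsClosed (Submodule.span ℂ {(1 : Adjointable A X)} : Set (Adjointable A X)) :=
    Submodule.closed_of_finiteDimensional _
  have hsub : ∀ T ∈ compactOperators A X, ∃ c : ℂ, T = c • (1 : Adjointable A X) := by
    intro T hT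
    have h1 : (finiteRank A X : Set (Adjointable A X)) ⊆
        Submodule.span ℂ {(1 : Adjointable A X)} := by
      refine (Submodule.span_le (p := Submodule.span ℂ {(1 : Adjointable A X)})).2 ?_
      rintro _ ⟨⟨x, y⟩, rfl⟩
      obtain ⟨c, hc⟩ := hspan x y
      exact Submodule.mem_span_singleton.2 ⟨c, hc.symm⟩
    have h2 : T ∈ closure (finiteRank A X : Set (Adjointable A X)) := hT
    obtain ⟨c, hc⟩ := Submodule.mem_span_singleton.1 (closure_minimal h1 hcl h2)
    exact ⟨c, hc.symm⟩
  obtain ⟨x, hx⟩ := exists_ne (0 : X)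
  have hz := norm_inv_norm_smul hx
  have hone : (1 : Adjointable A X) ∈ compactOperators A X := by
    rw [show (1 : Adjointable A X) = theta A _ _ from Adjointable.ext fun v => (h _ v hz).symm]
    exact theta_mem_compactOperators _ _
  refine nonempty_starAlgEquiv_complex (e := (⟨1, hone⟩ : compactOperators A X)) ?_
    (Subtype.ext (one_mul 1)) (Subtype.ext (star_one _)) fun T => ?_
  · intro h0
    have h1 : (1 : Adjointable A X) = 0 := congrArg Subtype.val h0
    exact hx (congrArg (fun T : Adjointable A X => T.op x) h1)
  · obtain ⟨c, hc⟩ := hsub T T.2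
    exact ⟨c, Subtype.ext hc⟩

/-- The defect `v - z⟪z, v⟫` normalises to a unit `w` orthogonal to `z`, with the same projection
`p`. In `y = (y - z⟪z, y⟫) + z⟪z, y⟫` the first term is orthogonal to `z` and the second to `w`, so
`p` fixes both. -/
theorem op_smul_ip_self_eq_of_exists_ne
    (H : ∀ x y : X, BirkhoffJamesOrthogonal x y → ‖y‖ ≤ ‖x + y‖) {z v : X} (hz : ‖z‖ = 1)
    (h : z <• ip A z v ≠ v) (y : X) : y <• ip A z z = y := by
  have horth : ∀ {z : X} (_ : ‖z‖ = 1) (u : X), ip A z (u - z <• ip A z u) = 0 := fun hz u => by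
    rw [ip_sub_right, ip_op_smul_right, ip_self_mul_ip H hz, sub_self]
  have hw0 : v - z <• ip A z v ≠ 0 := sub_ne_zero.2 h.symm
  set w := ((‖v - z <• ip A z v‖ : ℂ)⁻¹) • (v - z <• ip A z v) with hwdef
  have hw : ‖w‖ = 1 := norm_inv_norm_smul hw0
  have hzw : ip A z w = 0 := by rw [hwdef, ip_smul_right, horth hz, smul_zero]
  have hpq : ip A z z = ip A w w := ip_self_eq_of_ip_eq_zero H hz hw hzw
  have h1 : (y - z <• ip A z y) <• ip A z z = y - z <• ip A z y :=
    op_smul_eq_of_ip_eq_zero H hz (horth hz y)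
  have h2 : (z <• ip A z y) <• ip A z z = z <• ip A z y := by
    rw [hpq]
    refine op_smul_eq_of_ip_eq_zero H hw ?_
    rw [ip_op_smul_right, ip_eq_zero_symm hzw, zero_mul]
  rw [← sub_add_cancel y (z <• ip A z y), add_op_smul, h1, h2]

end Reverse

end HilbertModule

theorem mainTheorem4 {A X : Type*} [NonUnitalCStarAlgebra A] [PartialOrder A] [StarOrderedRing A]
    [NormedAddCommGroup X] [NormedSpace ℂ X] [CompleteSpace X]
    [SMul Aᵐᵒᵖ X] [CStarModule Aᵐᵒᵖ X] [Nontrivial X]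
    (hfull : HilbertModule.IsFull A X) :
    (∀ x y : X, HilbertModule.BirkhoffJamesOrthogonal x y → ‖x + y‖ ≥ ‖y‖) ↔
      (Nonempty (A ≃⋆ₐ[ℂ] ℂ) ∨ Nonempty (HilbertModule.compactOperators A X ≃⋆ₐ[ℂ] ℂ)) := by
  constructor
  · intro H
    by_cases h : ∀ z v : X, ‖z‖ = 1 → z <• HilbertModule.ip A z v = v
    · exact Or.inr (HilbertModule.nonempty_compactOperators_starAlgEquiv H h)
    · push Not at h
      obtain ⟨z, v, hz, hv⟩ := h
      exact Or.inl (HilbertModule.nonempty_starAlgEquiv_of_op_smul_eq H hfull hz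
        (HilbertModule.op_smul_ip_self_eq_of_exists_ne H hz hv))
  · rintro (⟨⟨φ⟩⟩ | ⟨⟨φ⟩⟩)
    · exact HilbertModule.norm_le_norm_add_of_starAlgEquiv φ
    · exact HilbertModule.norm_le_norm_add_of_compactOperators_starAlgEquiv φ
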